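/- A \emph{representation} of a set $X$ is a surjective partial map $\delta_X:\subseteq\mathbb{N}^{\mathbb{N}}\to X$; then $(X,\delta_X)$ is called a \emph{represented space}, and it carries the final topology $\mathcal{O}(X)=\{U\subseteq X:\delta_X^{-1}(U)\text{ is open in }\mathrm{dom}(\delta_X)\}$. A partial function $F:\subseteq\mathbb{N}^{\mathbb{N}}\to\mathbb{N}^{\mathbb{N}}$ \emph{realizes} a partial map $f:\subseteq X\to Y$ between represented spaces if $\delta_Y(F(p))=f(\delta_X(p))$ for all $p\in\mathrm{dom}(f\circ\delta_X)$, and $f$ is \emph{continuous with respect to the representations} if it has a realizer that is continuous on its domain. A representation $\delta_X$ of $X$ is \emph{admissible} with respect to a topology $\tau$ on $X$ if (1) $\delta_X$ is continuous with respect to $\tau$ on its domain, and (2) every representation $\delta:\subseteq\mathbb{N}^{\mathbb{N}}\to X$ that is continuous with respect to $\tau$ on its domain is also continuous with respect to the representation $\delta_X$, i.e., there is a partial function $F:\subseteq\mathbb{N}^{\mathbb{N}}\to\mathbb{N}^{\mathbb{N}}$, continuous on its domain, with $\delta_X(F(p))=\delta(p)$ for all $p\in\mathrm{dom}(\delta)$.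 For a represented space $Y$, let $\delta_{\mathcal{O}(Y)}$ be the standard representation of $\mathcal{O}(Y)$: $\delta_{\mathcal{O}(Y)}(p)=U$ if and only if the partial continuous function $\eta_p:\subseteq\mathbb{N}^{\mathbb{N}}\to\mathbb{N}^{\mathbb{N}}$ with code (Kleene associate) $p$ realizes the characteristic function $\chi_U:Y\to\mathbb{S}$ into Sierpi\'nski space $\mathbb{S}=\{0,1\}$, where the constant zero sequence is the only name of $0\in\mathbb{S}$ and all other sequences are names of $1$. Here $\eta_p(q)(n)=p\langle n,q|_k\rangle-1$ for the least $k$ with $p\langle n,q|_k\rangle\neq0$, where $q|_k$ is the prefix of $q$ of length $k$ and $\langle\cdot\rangle$ is a standard coding of pairs of a number and a finite word by numbers; $\eta_p(q)$ is defined if and only if such a $k$ exists for every $n$. A family $(B_y)_{y\in Y}$ of subsets of a set $X$, indexed by a represented space $Y$, is a \emph{presubbase} of $X$ if $\{y\in Y:x\in B_y\}\in\mathcal{O}(Y)$ for every $x\in X$ and the map $X\to\mathcal{O}(Y)$, $x\mapsto\{y\in Y:x\in B_y\}$ is injective. Its \emph{presubbase representation} $\delta^B:\subseteq\mathbb{N}^{\mathbb{N}}\to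 X$ is defined by \[\delta^B(p)=x:\iff\delta_{\mathcal{O}(Y)}(p)=\{y\in Y:x\in B_y\}.\] The presubbase has the \emph{convergent intersection property} if for every sequence $(y_n)_{n\in\mathbb{N}}$ in $Y$ and every $y_\infty\in Y$ such that $y_n\to y_\infty$ with respect to $\mathcal{O}(Y)$, there is a finite set $F\subseteq Y$ with \[B_{y_\infty}\cap\bigcap_{n\in\mathbb{N}}B_{y_n}=\bigcap_{y\in F}B_y,\] where the empty intersection is $X$. \textbf{Corollary 12 (Convergent intersection property).} Let $(B_y)_{y\in Y}$ be a presubbase of a set $X$ that satisfies the convergent intersection property. Then $\delta^B$ is admissible with respect to the topology $\tau$ on $X$ that is generated by $\{B_y:y\in Y\}$ as a subbase. -/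

import Mathlib

open Filter Topology

/-- Baire space, with the product of the discrete topologies. -/
abbrev Baire : Type := ℕ → ℕ

/-- A partial map out of a topological space is continuous with respect to a topology `τ` on its
codomain if its restriction to its domain (with the subspace topology) is continuous. -/
def PartialContinuous {A X : Type*} [TopologicalSpace A] (τ : TopologicalSpace X)
    (f : A →. X) : Prop :=
  @Continuous f.Dom X inferInstance τ f.asSubtype

/-- A representation of `X`: a surjective partial map from Baire space to `X`. -/
structure BaireRep (X : Type*) where
  /-- The underlying partial map; `x ∈ toPFun p` says that `p` is a name of `x`. -/
  toPFun : Baire →. X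
  surj : ∀ x, ∃ p, x ∈ toPFun p

namespace BaireRep

/-- The identity representation of Baire space. -/
def baire : BaireRep Baire where
  toPFun := PFun.id Baire
  surj := fun x => ⟨x, Part.mem_some x⟩

/-- The standard representation of Sierpiński space (in Mathlib: `Prop`): `0^ω` is the only name
of the bottom element and every other sequence is a name of the top element. -/
def sierpinski : BaireRep Prop where
  toPFun := fun p => Part.some (∃ n, p n ≠ 0)
  surj := by
    intro P
    by_cases hP : P
    · exact ⟨fun _ => 1, by simp [hP]⟩
    · exact ⟨fun _ => 0, by simp [hP]⟩

/-- The final topology of a represented space. -/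
@[reducible]
def finalTopology {X : Type*} (δ : BaireRep X) : TopologicalSpace X :=
  TopologicalSpace.coinduced δ.toPFun.asSubtype inferInstance

/-- `F` realizes the partial single-valued map `f`: whenever `p` is a name of a point `x` in the
domain of `f`, then `F p` is defined and is a name of `f x`. -/
def Realizes {X Y : Type*} (δX : BaireRep X) (δY : BaireRep Y) (F : Baire →. Baire)
    (f : X →. Y) : Prop :=
  ∀ p, ∀ x ∈ δX.toPFun p, ∀ y ∈ f x, ∃ q ∈ F p, y ∈ δY.toPFun q

/-- `f` is continuous with respect to the representations: it has a continuous realizer. -/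
def RepContinuous {X Y : Type*} (δX : BaireRep X) (δY : BaireRep Y) (f : X →. Y) : Prop :=
  ∃ F : Baire →. Baire, PartialContinuous inferInstance F ∧ Realizes δX δY F f

/-- `δ` is admissible with respect to the topology `τ`: it is continuous with respect to `τ`, and
every representation that is continuous with respect to `τ` is, as a partial map from Baire space,
continuous with respect to the representation `δ`. -/
def Admissible {X : Type*} (δ : BaireRep X) (τ : TopologicalSpace X) : Prop :=
  PartialContinuous τ δ.toPFun ∧
    ∀ δ' : BaireRep X, PartialContinuous τ δ'.toPFun → RepContinuous baire δ δ'.toPFun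

end BaireRep

/-- The code of a number `n` together with the prefix of `q` of length `k`. -/
def prefixCode (n : ℕ) (q : Baire) (k : ℕ) : ℕ :=
  Encodable.encode (n, (List.range k).map q)

/-- The partial continuous function with associate `p` (in Kleene's sense): the value of
`kleene p q` at `n` is `m` if `p` takes the value `m + 1` on the code of `n` and the shortest
prefix of `q` for which `p` does not answer `0`. -/
def kleene (p : Baire) : Baire →. Baire := fun q =>
  { Dom := ∀ n, ∃ k, p (prefixCode n q k) ≠ 0
    get := fun h n => p (prefixCode n q (Nat.find (h n))) - 1 }

namespace BaireRep

/-- The function space representation: `p` is a name of the total function `f` if the partial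
continuous function with associate `p` realizes `f`. -/
def NamesFunction {X Y : Type*} (δX : BaireRep X) (δY : BaireRep Y) (p : Baire) (f : X → Y) :
    Prop :=
  Realizes δX δY (kleene p) (f : X →. Y)

/-- The open sets of a represented space, with respect to its final topology. -/
abbrev OpenSets {Y : Type*} (δ : BaireRep Y) : Type _ :=
  {U : Set Y // IsOpen[δ.finalTopology] U}

/-- `p` is a name of the open set `U` if it is a name of the characteristic function of `U` as a
function into Sierpiński space. -/
def NamesOpen {Y : Type*} (δ : BaireRep Y) (p : Baire) (U : δ.OpenSets) : Prop :=
  NamesFunction δ sierpinski p (fun y => y ∈ U.1)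

theorem NamesOpen.unique {Y : Type*} {δ : BaireRep Y} {p : Baire} {U V : δ.OpenSets}
    (hU : δ.NamesOpen p U) (hV : δ.NamesOpen p V) : U = V := by
  have key : U.1 = V.1 := by
    ext y
    obtain ⟨q, hq⟩ := δ.surj y
    obtain ⟨r, hr, h1⟩ := hU q y hq _ (Part.mem_some _)
    obtain ⟨s, hs, h2⟩ := hV q y hq _ (Part.mem_some _)
    obtain rfl := Part.mem_unique hr hs
    exact iff_of_eq (Part.mem_unique h1 h2)
  exact Subtype.ext key

theorem exists_namesOpen {Y : Type*} (δ : BaireRep Y) (U : δ.OpenSets) :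
    ∃ p, δ.NamesOpen p U := by
  classical
  have hU : IsOpen (δ.toPFun.asSubtype ⁻¹' U.1) := U.2
  obtain ⟨V, hV, hVU⟩ := isOpen_induced_iff.1 hU
  let p : Baire := fun c =>
    match (Encodable.decode c : Option (ℕ × List ℕ)) with
    | none => 0
    | some (n, w) =>
      if w.length < n then 0
      else if ∀ q : Baire, (List.range w.length).map q = w → q ∈ V then 2 else 1
  have hp : ∀ n q k, p (prefixCode n q k) =
      if k < n then 0
      else if ∀ q' : Baire, (List.range k).map q' = (List.range k).map q → q' ∈ V
        then 2 else 1 := by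
    intro n q k
    simp [p, prefixCode]
  have hdom : ∀ q n, ∃ k, p (prefixCode n q k) ≠ 0 := by
    intro q n
    refine ⟨n, ?_⟩
    rw [hp]
    simp only [lt_irrefl, if_false]
    split_ifs <;> simp
  refine ⟨p, ?_⟩
  intro q y hy b hb
  obtain rfl := Part.mem_some_iff.1 hb
  refine ⟨(kleene p q).get (hdom q), Part.get_mem _, ?_⟩
  refine Part.mem_some_iff.2 (propext ?_)
  have hyV : y ∈ U.1 ↔ q ∈ V := by
    have hq : q ∈ δ.toPFun.Dom := Part.dom_iff_mem.2 ⟨y, hy⟩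
    have h := Set.ext_iff.1 hVU ⟨q, hq⟩
    have hval : δ.toPFun.asSubtype ⟨q, hq⟩ = y := Part.get_eq_of_mem hy hq
    simp only [Set.mem_preimage, hval] at h
    exact h.symm
  refine hyV.trans ?_
  constructor
  · intro hqV
    obtain ⟨_, ⟨x, m, rfl⟩, hqc, hsub⟩ :=
      (PiNat.isTopologicalBasis_cylinders (fun _ : ℕ => ℕ)).exists_subset_of_mem_open hqV hV
    refine ⟨m, ?_⟩
    change p (prefixCode m q (Nat.find (hdom q m))) - 1 ≠ 0
    have hk := Nat.find_spec (hdom q m)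
    generalize Nat.find (hdom q m) = k at hk
    rw [hp] at hk ⊢
    have hmk : ¬ k < m := fun h => hk (by simp [h])
    have hall : ∀ q' : Baire, (List.range k).map q' = (List.range k).map q → q' ∈ V := by
      intro q' hq'
      apply hsub
      intro i hi
      have h2 : q' i = q i := List.map_inj_left.1 hq' i (List.mem_range.2 (by omega))
      rw [h2]
      exact hqc i hi
    rw [if_neg hmk, if_pos hall]
    simp
  · rintro ⟨n, hn⟩
    change p (prefixCode n q (Nat.find (hdom q n))) - 1 ≠ 0 at hn
    generalize Nat.find (hdom q n) = k at hn
    rw [hp] at hn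
    split_ifs at hn with h1 h2
    · simp at hn
    · exact h2 q rfl
    · simp at hn

/-- The standard representation of the open sets of a represented space. -/
noncomputable def openSets {Y : Type*} (δ : BaireRep Y) : BaireRep δ.OpenSets where
  toPFun := fun p => { Dom := ∃ U, δ.NamesOpen p U, get := fun h => h.choose }
  surj := fun U => by
    obtain ⟨p, hp⟩ := δ.exists_namesOpen U
    exact ⟨p, ⟨U, hp⟩, NamesOpen.unique (Exists.choose_spec (⟨U, hp⟩ : ∃ U, δ.NamesOpen p U)) hp⟩

theorem mem_openSets {Y : Type*} (δ : BaireRep Y) (p : Baire) (U : δ.OpenSets) :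
    U ∈ δ.openSets.toPFun p ↔ δ.NamesOpen p U := by
  constructor
  · rintro ⟨h, rfl⟩
    exact Exists.choose_spec h
  · intro hp
    exact ⟨⟨U, hp⟩, NamesOpen.unique (Exists.choose_spec (⟨U, hp⟩ : ∃ U, δ.NamesOpen p U)) hp⟩

end BaireRep

/-- A family `B` of subsets of `X`, indexed by a represented space, is a presubbase if its
transpose `x ↦ {y | x ∈ B y}` is well-defined as a map to the open sets, and injective. -/
structure IsPresubbase {X Y : Type*} (δY : BaireRep Y) (B : Y → Set X) : Prop where
  isOpen_transpose : ∀ x, IsOpen[δY.finalTopology] {y | x ∈ B y}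
  injective_transpose : Function.Injective fun x => {y | x ∈ B y}

namespace IsPresubbase

/-- The transpose of a presubbase. -/
def transpose {X Y : Type*} {δY : BaireRep Y} {B : Y → Set X} (hB : IsPresubbase δY B) (x : X) :
    δY.OpenSets :=
  ⟨{y | x ∈ B y}, hB.isOpen_transpose x⟩

theorem transpose_injective {X Y : Type*} {δY : BaireRep Y} {B : Y → Set X}
    (hB : IsPresubbase δY B) : Function.Injective hB.transpose := by
  intro x x' h
  exact hB.injective_transpose (congrArg Subtype.val h)

/-- The presubbase representation: `p` is a name of `x` if and only if `p` is a name of the open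
set `{y | x ∈ B y}` (see `mem_rep`). -/
noncomputable def rep {X Y : Type*} {δY : BaireRep Y} {B : Y → Set X} (hB : IsPresubbase δY B) :
    BaireRep X where
  toPFun := fun p =>
    { Dom := ∃ x, hB.transpose x ∈ δY.openSets.toPFun p
      get := fun h => h.choose }
  surj := fun x => by
    obtain ⟨p, hp⟩ := δY.openSets.surj (hB.transpose x)
    have h : ∃ x, hB.transpose x ∈ δY.openSets.toPFun p := ⟨x, hp⟩
    exact ⟨p, h, hB.transpose_injective (Part.mem_unique h.choose_spec hp)⟩

theorem mem_rep {X Y : Type*} {δY : BaireRep Y} {B : Y → Set X} (hB : IsPresubbase δY B)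
    (p : Baire) (x : X) :
    x ∈ hB.rep.toPFun p ↔ hB.transpose x ∈ δY.openSets.toPFun p := by
  constructor
  · rintro ⟨h, rfl⟩
    exact Exists.choose_spec h
  · intro hp
    have h : ∃ x, hB.transpose x ∈ δY.openSets.toPFun p := ⟨x, hp⟩
    exact ⟨h, hB.transpose_injective (Part.mem_unique h.choose_spec hp)⟩

end IsPresubbase

/-- The convergent intersection property. Convergence in `Y` is with respect to the final
topology. -/
def ConvergentIntersectionProperty {X Y : Type*} (δY : BaireRep Y) (B : Y → Set X) : Prop :=
  ∀ (y : ℕ → Y) (yInf : Y), Tendsto y atTop (@nhds Y δY.finalTopology yInf) →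
    ∃ F : Set Y, F.Finite ∧ (⋂ n, B (y n)) ∩ B yInf = ⋂ z ∈ F, B z

/-! Continuity of the presubbase representation needs only one fixed name of each `y`: a name of `x`
reveals `x ∈ B y` after finitely many of its values (`isOpen_kleene_ne_zero`). For maximality, let
`δ` be continuous. The relation `δ p ∈ B (δY q)` is open in the names `(p, q)` (`isOpen_mem_names`).
Sequences suffice to test this, and there the convergent intersection property replaces an infinite
intersection by a finite, hence open, one (`eventually_mem_of_tendsto`). Extending the relation to
an open `W` in the full product and currying it gives `sectionAssociate W`, which continuously turns
a `δ`-name of `x` into a name of `{y | x ∈ B y}`. -/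

theorem isOpen_agree_on_finset (s : Finset ℕ) (p : Baire) :
    IsOpen {p' : Baire | ∀ c ∈ s, p' c = p c} := by
  have h : {p' : Baire | ∀ c ∈ s, p' c = p c} = ⋂ c ∈ s, {p' : Baire | p' c = p c} := by
    ext; simp
  rw [h]
  exact isOpen_biInter_finset fun c _ =>
    (isOpen_discrete {p c}).preimage (continuous_apply (A := fun _ : ℕ => ℕ) c)

theorem continuous_of_prefix_determined {α : Type*} [TopologicalSpace α] {f : Baire → α} (k : ℕ)
    (hf : ∀ p p' : Baire, (List.range k).map p' = (List.range k).map p → f p' = f p) :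
    Continuous f := by
  refine IsLocallyConstant.continuous ((IsLocallyConstant.iff_exists_open f).2 fun p => ?_)
  refine ⟨_, isOpen_agree_on_finset (Finset.range k) p, fun _ _ => rfl, fun p' hp' => ?_⟩
  exact hf p p' (List.map_inj_left.2 fun i hi => hp' i (by simpa using hi))

/-- Whether an associate produces a nonzero output on a fixed input is an open condition on the
associate, among those that are defined there. -/
theorem isOpen_kleene_ne_zero (q : Baire) :
    ∃ W : Set Baire, IsOpen W ∧
      ∀ p, ∀ r ∈ kleene p q, (p ∈ W ↔ ∃ n, r n ≠ 0) := by
  -- The bound is 2 because `kleene` subtracts 1 from the first nonzero answer. Only finitely many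
  -- values of `p` are inspected.
  refine ⟨{p | ∃ n k, (∀ j < k, p (prefixCode n q j) = 0) ∧ 2 ≤ p (prefixCode n q k)},
    ?_, ?_⟩
  · rw [isOpen_iff_mem_nhds]
    rintro p ⟨n, k, h0, h2⟩
    refine Filter.mem_of_superset
      ((isOpen_agree_on_finset ((Finset.range (k + 1)).image (prefixCode n q)) p).mem_nhds
        fun _ _ => rfl) fun p' hp' => ⟨n, k, fun j hj => ?_, ?_⟩
    · rw [hp' _ (Finset.mem_image_of_mem _ (by simp; omega)), h0 j hj]
    · rwa [hp' _ (Finset.mem_image_of_mem _ (by simp))]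
  · rintro p r ⟨hd, rfl⟩
    change _ ↔ ∃ n, p (prefixCode n q (Nat.find (hd n))) - 1 ≠ 0
    refine exists_congr fun n => ⟨?_, fun h => ?_⟩
    · rintro ⟨k, h0, h2⟩
      have hk : Nat.find (hd n) = k :=
        (Nat.find_eq_iff _).2 ⟨by omega, fun j hj => not_not.2 (h0 j hj)⟩
      rw [hk]
      omega
    · exact ⟨_, fun j hj => not_not.1 (Nat.find_min (hd n) hj), by omega⟩

/-! ### Currying open relations on Baire space -/

open Classical in
/-- An associate, depending on `p`, of the characteristic function of the section at `p` of a set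
`W` of pairs: on the code of `n` and a word `w` of length at least `n`, it answers `1` if
all pairs extending `w` and the prefix of `p` of the same length lie in `W`, and `0` otherwise. -/
noncomputable def sectionAssociate (W : Set (Baire × Baire)) (p : Baire) : Baire := fun c =>
  match (Encodable.decode c : Option (ℕ × List ℕ)) with
  | none => 0
  | some (n, w) =>
    if w.length < n then 0
    else if ∀ p' q' : Baire, (List.range w.length).map p' = (List.range w.length).map p →
        (List.range w.length).map q' = w → (p', q') ∈ W then 2 else 1

open Classical in
theorem sectionAssociate_prefixCode (W : Set (Baire × Baire)) (p q : Baire) (n k : ℕ) :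
    sectionAssociate W p (prefixCode n q k) =
      if k < n then 0
      else if ∀ p' q' : Baire, (List.range k).map p' = (List.range k).map p →
        (List.range k).map q' = (List.range k).map q → (p', q') ∈ W then 2 else 1 := by
  simp [sectionAssociate, prefixCode]

/-- Each entry, on a word `w`, consults only the prefix of `p` of length `w.length`. -/
theorem continuous_sectionAssociate (W : Set (Baire × Baire)) :
    Continuous (sectionAssociate W) := by
  refine continuous_pi fun c => ?_
  unfold sectionAssociate
  rcases (Encodable.decode c : Option (ℕ × List ℕ)) with _ | ⟨n, w⟩
  · exact continuous_const
  · refine continuous_of_prefix_determined w.length fun p p' h => ?_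
    dsimp only
    rw [h]

theorem kleene_sectionAssociate_dom (W : Set (Baire × Baire)) (p q : Baire) :
    (kleene (sectionAssociate W p) q).Dom := by
  intro n
  refine ⟨n, ?_⟩
  rw [sectionAssociate_prefixCode]
  simp only [lt_irrefl, if_false]
  split_ifs <;> simp

theorem exists_prefix_subset_of_isOpen {W : Set (Baire × Baire)} (hW : IsOpen W) {p q : Baire}
    (hpq : (p, q) ∈ W) :
    ∃ m, ∀ p' q' : Baire, (∀ i < m, p' i = p i) → (∀ i < m, q' i = q i) → (p', q') ∈ W := by
  obtain ⟨U, V, hU, hV, hpU, hqV, hUV⟩ := isOpen_prod_iff.1 hW p q hpq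
  have cyl : ∀ {S : Set Baire} {r : Baire}, IsOpen S → r ∈ S →
      ∃ m, ∀ r' : Baire, (∀ i < m, r' i = r i) → r' ∈ S := by
    intro S r hS hr
    obtain ⟨_, ⟨x, m, rfl⟩, hrc, hsub⟩ :=
      (PiNat.isTopologicalBasis_cylinders (fun _ : ℕ => ℕ)).exists_subset_of_mem_open hr hS
    exact ⟨m, fun r' hr' => hsub fun i hi => (hr' i hi).trans (hrc i hi)⟩
  obtain ⟨a, ha⟩ := cyl hU hpU
  obtain ⟨b, hb⟩ := cyl hV hqV
  exact ⟨max a b, fun p' q' hp' hq' => hUV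
    ⟨ha p' fun i hi => hp' i (lt_max_of_lt_left hi),
      hb q' fun i hi => hq' i (lt_max_of_lt_right hi)⟩⟩

/-- A nonzero output certifies a whole cylinder around `(p, q)` inside `W`; conversely, openness
supplies such a cylinder, and a large output index forces prefixes long enough to lie in it. -/
theorem kleene_sectionAssociate_ne_zero_iff {W : Set (Baire × Baire)} (hW : IsOpen W)
    {p q r : Baire} (hr : r ∈ kleene (sectionAssociate W p) q) :
    (∃ n, r n ≠ 0) ↔ (p, q) ∈ W := by
  obtain ⟨hd, rfl⟩ := hr
  change (∃ n, sectionAssociate W p (prefixCode n q (Nat.find (hd n))) - 1 ≠ 0) ↔ _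
  constructor
  · rintro ⟨n, hn⟩
    rw [sectionAssociate_prefixCode] at hn
    split_ifs at hn with h1 h2
    · simp at hn
    · exact h2 p q rfl rfl
    · simp at hn
  · intro hpq
    obtain ⟨m, hm⟩ := exists_prefix_subset_of_isOpen hW hpq
    -- At output index `m`, words shorter than `m` get no answer, so the first answer already sees
    -- the cylinder of length `m`.
    refine ⟨m, ?_⟩
    have hk := Nat.find_spec (hd m)
    generalize Nat.find (hd m) = k at hk
    rw [sectionAssociate_prefixCode] at hk ⊢
    have hmk : ¬ k < m := fun h => hk (by simp [h])
    have hall : ∀ p' q' : Baire, (List.range k).map p' = (List.range k).map p →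
        (List.range k).map q' = (List.range k).map q → (p', q') ∈ W := fun p' q' hp' hq' =>
      hm p' q' (fun i hi => List.map_inj_left.1 hp' i (List.mem_range.2 (by omega)))
        fun i hi => List.map_inj_left.1 hq' i (List.mem_range.2 (by omega))
    rw [if_neg hmk, if_pos hall]
    simp

/-! ### Topology of the presubbase -/

namespace IsPresubbase

variable {X Y : Type*} {δY : BaireRep Y} {B : Y → Set X}

theorem mem_rep_iff_namesOpen (hB : IsPresubbase δY B) (p : Baire) (x : X) :
    x ∈ hB.rep.toPFun p ↔ δY.NamesOpen p (hB.transpose x) :=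
  (hB.mem_rep p x).trans (δY.mem_openSets p _)

/-- The presubbase representation is continuous with respect to the topology generated by the
presubbase. -/
theorem partialContinuous_rep (hB : IsPresubbase δY B) :
    PartialContinuous (TopologicalSpace.generateFrom (Set.range B)) hB.rep.toPFun := by
  refine continuous_generateFrom_iff.2 ?_
  rintro _ ⟨y, rfl⟩
  obtain ⟨q, hq⟩ := δY.surj y
  obtain ⟨W, hW, hWq⟩ := isOpen_kleene_ne_zero q
  refine isOpen_induced_iff.2 ⟨W, hW, ?_⟩
  ext ⟨p, hp⟩
  have hmem : hB.rep.toPFun.asSubtype ⟨p, hp⟩ ∈ hB.rep.toPFun p := Part.get_mem hp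
  obtain ⟨r, hr, hyr⟩ := (hB.mem_rep_iff_namesOpen _ _).1 hmem q y hq _ (Part.mem_some _)
  exact (hWq p r hr).trans (iff_of_eq (Part.mem_some_iff.1 hyr)).symm

/-- Under the convergent intersection property, membership `x ∈ B y` is jointly sequentially open
for sequences converging in the generated topology and in the final topology, respectively. -/
theorem eventually_mem_of_tendsto (hB : IsPresubbase δY B)
    (hconv : ConvergentIntersectionProperty δY B) {x : ℕ → X} {xInf : X} {y : ℕ → Y} {yInf : Y}
    (hx : Tendsto x atTop (@nhds X (TopologicalSpace.generateFrom (Set.range B)) xInf))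
    (hy : Tendsto y atTop (@nhds Y δY.finalTopology yInf)) (h : xInf ∈ B yInf) :
    ∀ᶠ n in atTop, x n ∈ B (y n) := by
  let _ : TopologicalSpace X := TopologicalSpace.generateFrom (Set.range B)
  let _ : TopologicalSpace Y := δY.finalTopology
  obtain ⟨N, hN⟩ := eventually_atTop.1 (hy ((hB.isOpen_transpose xInf).mem_nhds h))
  -- Dropping the first `N` terms puts `xInf` in every set of the intersection.
  obtain ⟨F, hF, hFB⟩ := hconv (fun n => y (n + N)) yInf (hy.comp (tendsto_add_atTop_nat N))
  have hopen : IsOpen (⋂ z ∈ F, B z) := hF.isOpen_biInter fun z _ =>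
    TopologicalSpace.isOpen_generateFrom_of_mem (Set.mem_range_self z)
  have hmem : xInf ∈ ⋂ z ∈ F, B z := by
    rw [← hFB]
    exact ⟨Set.mem_iInter.2 fun n => hN _ (Nat.le_add_left _ _), h⟩
  filter_upwards [hx (hopen.mem_nhds hmem), eventually_ge_atTop N] with n hn hNn
  have hn' : x n ∈ ⋂ z ∈ F, B z := hn
  rw [← hFB] at hn'
  simpa [Nat.sub_add_cancel hNn] using Set.mem_iInter.1 hn'.1 (n - N)

/-- Under the convergent intersection property, membership `x ∈ B y` is an open relation between
the names of `x` in any continuous partial map and the names of `y`. -/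
theorem isOpen_mem_names (hB : IsPresubbase δY B)
    (hconv : ConvergentIntersectionProperty δY B) {δ : Baire →. X}
    (hδ : PartialContinuous (TopologicalSpace.generateFrom (Set.range B)) δ) :
    IsOpen {a : δ.Dom × δY.toPFun.Dom | δ.asSubtype a.1 ∈ B (δY.toPFun.asSubtype a.2)} := by
  let _ : TopologicalSpace X := TopologicalSpace.generateFrom (Set.range B)
  let _ : TopologicalSpace Y := δY.finalTopology
  have hδc : Continuous δ.asSubtype := hδ
  have hYc : Continuous δY.toPFun.asSubtype := continuous_coinduced_rng
  rw [isOpen_iff_mem_nhds]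
  intro a ha
  -- Sequences suffice because the domains, as subspaces of Baire space, are first countable.
  refine eventually_iff_seq_eventually.2 fun u hu => ?_
  have hu' := (nhds_prod_eq (x := a.1) (y := a.2)) ▸ hu
  exact hB.eventually_mem_of_tendsto hconv
    ((hδc.tendsto _).comp hu'.fst) ((hYc.tendsto _).comp hu'.snd) ha

end IsPresubbase

theorem corollary12 {X Y : Type*} (δY : BaireRep Y) (B : Y → Set X) (hB : IsPresubbase δY B)
    (hconv : ConvergentIntersectionProperty δY B) :
    hB.rep.Admissible (TopologicalSpace.generateFrom (Set.range B)) := by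
  refine ⟨hB.partialContinuous_rep, fun δ hδ => ?_⟩
  -- The domains need not be open, so `W` is only constrained on pairs of names; its values
  -- elsewhere are irrelevant, and the realizer can be total.
  obtain ⟨W, hW, hWB⟩ := (Topology.IsInducing.subtypeVal.prodMap
    Topology.IsInducing.subtypeVal).isOpen_iff.1 (hB.isOpen_mem_names hconv hδ)
  refine ⟨(sectionAssociate W : Baire →. Baire),
    (continuous_sectionAssociate W).comp continuous_subtype_val, ?_⟩
  intro p p' hp x hx
  obtain rfl : p = p' := (Part.mem_some_iff.1 hp).symm
  refine ⟨_, Part.mem_some _, (hB.mem_rep_iff_namesOpen _ _).2 ?_⟩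
  intro q y hy b hb
  obtain rfl := Part.mem_some_iff.1 hb
  have hr := Part.get_mem (kleene_sectionAssociate_dom W p q)
  refine ⟨_, hr, Part.mem_some_iff.2 (propext ?_)⟩
  rw [kleene_sectionAssociate_ne_zero_iff hW hr]
  obtain ⟨hpd, rfl⟩ := hx
  obtain ⟨hqd, rfl⟩ := hy
  exact (Set.ext_iff.1 hWB (⟨_, hpd⟩, ⟨q, hqd⟩)).symm
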